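/- **Terms.** $\Lambda$-terms are given by $t ::= x \mid t\,t \mid \lambda x.t \mid t[x/t]$, where $\lambda x.t$ and $t[x/u]$ bind $x$ in $t$; they are considered up to $\alpha$-conversion, and ${\tt fv}(t)$ is the set of free variables of $t$. Contexts are $C ::= \Box \mid C\,t \mid t\,C \mid \lambda x.C \mid C[x/t] \mid t[x/C]$. **$\lambda_{sub}$.** The relation $\to_{\lambda_{sub}}$ is the closure under all contexts of the rules - $(\lambda x.t)\,u \to t[x/u]$; - $t[x/u] \to t$ if $x \notin {\tt fv}(t)$; - $C\langle x\rangle[x/u] \to C\langle u\rangle[x/u]$, where the context $C$ captures neither $x$ nor any free variable of $u$. **$\lambda{\tt es}$.** Let $=_{\tt Es}$ be the congruence generated by $\alpha$-conversion and $t[x/u][y/v] = t[y/v][x/u]$ for $y \notin {\tt fv}(u)$, $x \notin {\tt fv}(v)$. The ${\tt ALC}$ rules are - $(t\,u)[x/v] \to t[x/v]\,u[x/v]$ if $x \in {\tt fv}(t)$ and $x \in {\tt fv}(u)$; - $(t\,u)[x/v] \to t\,u[x/v]$ if $x \notin {\tt fv}(t)$ and $x \in {\tt fv}(u)$; - $(t\,u)[x/v]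 \to t[x/v]\,u$ if $x \in {\tt fv}(t)$ and $x \notin {\tt fv}(u)$; - $(\lambda y.t)[x/v] \to \lambda y.t[x/v]$; - $t[x/u][y/v] \to t[y/v][x/u[y/v]]$ if $y \in {\tt fv}(u)$ and $y \in {\tt fv}(t)$; - $t[x/u][y/v] \to t[x/u[y/v]]$ if $y \in {\tt fv}(u)$ and $y \notin {\tt fv}(t)$. The $\lambda{\tt es}$ rules are these together with $(\lambda x.t)\,u \to t[x/u]$, $x[x/u] \to u$, and $t[x/u] \to t$ if $x \notin {\tt fv}(t)$ (bound variables being chosen so that no capture occurs). The relations $\to_{\tt ALC}$ and $\to_{\lambda{\tt es}}$ are the closures of the respective rules under all contexts, taken modulo $=_{\tt Es}$; that is, $t \to t'$ iff $t =_{\tt Es} s \to s' =_{\tt Es} t'$, where $s \to s'$ applies one rule inside a context. An ${\tt ALC}$-normal form of $t$ is a term $s$ that has no $\to_{\tt ALC}$-step and satisfies $t =_{\tt Es} s$ or $t \to^+_{\tt ALC} s$. Here $\to^+$ denotes one or more steps. Let ${\tt ALC}$ be a function choosing an ${\tt ALC}$-normal form of each term. **Translation.** With $\overline{y}$ always a fresh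 variable, $$\begin{array}{lcll} T(x) &=& x & \\ T(\lambda x.t) &=& \lambda x.T(t) & \\ T(t\,u) &=& (T(t)\,T(u))[\overline{y}/T(u)] & \\ T(t[y/u]) &=& {\tt ALC}(T(t)[y/T(u)]) & \text{if } y\notin{\tt fv}(t)\\ T(t[y/u]) &=& {\tt ALC}(T(t)[y/T(u)][\overline{y}/T(u)]) & \text{if } y\in{\tt fv}(t).\end{array}$$ **Proposition ($\lambda{\tt es}$ simulates $\lambda_{sub}$).** Every $\Lambda$-term has an ${\tt ALC}$-normal form, unique modulo $=_{\tt Es}$ (so $T$ is well defined), and $T(t)$ is ${\tt ALC}$-normal for every $\Lambda$-term $t$. For all $\Lambda$-terms $t, t'$, if $t \to_{\lambda_{sub}} t'$, then $T(t) \to^+_{\lambda{\tt es}} T(t')$. -/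

import Mathlib

namespace LambdaSub

/-! ### Terms modulo renaming of bound variables

`Λ`-terms up to `α`-conversion are represented with de Bruijn indices, so that `α`-equivalence
is equality. -/

/-- `Λ`-terms `t ::= x ∣ t t ∣ λ x. t ∣ t[x/t]`, up to `α`-conversion.
In `lam t` and in `clos t u` (that is, `t[x/u]`) the bound variable is the index `0` of `t`;
the index `n + 1` of `t` is the variable `n` of the whole term. -/
inductive Term : Type
  | var (n : ℕ) : Term
  | app (t u : Term) : Term
  | lam (t : Term) : Term
  | clos (t u : Term) : Term

namespace Term

/-- Extend a renaming under a binder. -/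
def liftRen (ρ : ℕ → ℕ) : ℕ → ℕ
  | 0 => 0
  | n + 1 => ρ n + 1

/-- Capture-avoiding renaming of the free variables. -/
def rename : (ℕ → ℕ) → Term → Term
  | ρ, var n => var (ρ n)
  | ρ, app t u => app (rename ρ t) (rename ρ u)
  | ρ, lam t => lam (rename (liftRen ρ) t)
  | ρ, clos t u => clos (rename (liftRen ρ) t) (rename ρ u)

/-- The free variables. -/
def fv : Term → Set ℕ
  | var n => {n}
  | app t u => fv t ∪ fv u
  | lam t => {n | n + 1 ∈ fv t}
  | clos t u => {n | n + 1 ∈ fv t} ∪ fv u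

/-- The same term, placed under one more binder (which it does not mention). -/
def shift (t : Term) : Term := rename Nat.succ t

/-- A term taken out of the scope of the innermost binder; used when `0 ∉ fv t`. -/
def unshift (t : Term) : Term := rename Nat.pred t

/-- Exchange of the two innermost binders. -/
def swap (t : Term) : Term :=
  rename (fun n => match n with
    | 0 => 1
    | 1 => 0
    | k + 2 => k + 2) t

end Term

open Term

/-! ### Contexts and closure under contexts -/

/-- `Λ`-contexts `C ::= □ ∣ C t ∣ t C ∣ λ x. C ∣ C[x/t] ∣ t[x/C]`. -/
inductive Ctx : Type
  | hole : Ctx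
  | appL (C : Ctx) (t : Term) : Ctx
  | appR (t : Term) (C : Ctx) : Ctx
  | lam (C : Ctx) : Ctx
  | closL (C : Ctx) (t : Term) : Ctx
  | closR (t : Term) (C : Ctx) : Ctx

/-- Filling the hole of a context with `s` without capturing any free variable of `s`:
`s` is shifted each time a binder of the context is crossed. -/
def Ctx.fill : Ctx → Term → Term
  | .hole, s => s
  | .appL C t, s => app (C.fill s) t
  | .appR t C, s => app t (C.fill s)
  | .lam C, s => Term.lam (C.fill (shift s))
  | .closL C t, s => clos (C.fill (shift s)) t
  | .closR t C, s => clos t (C.fill s)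

/-- Closure of a relation under all contexts (capture of variables being allowed). -/
inductive Compat (R : Term → Term → Prop) : Term → Term → Prop
  | root {t t'} : R t t' → Compat R t t'
  | appL {t t'} (u) : Compat R t t' → Compat R (app t u) (app t' u)
  | appR (t) {u u'} : Compat R u u' → Compat R (app t u) (app t u')
  | lam {t t'} : Compat R t t' → Compat R (lam t) (lam t')
  | closL {t t'} (u) : Compat R t t' → Compat R (clos t u) (clos t' u)
  | closR (t) {u u'} : Compat R u u' → Compat R (clos t u) (clos t u')

/-! ### The calculus with partial substitution -/

/-- The rules `B`, `Gc` and `R`. -/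
inductive SubRule : Term → Term → Prop
  /-- `(λ x. t) u → t[x/u]` -/
  | b (t u) : SubRule (app (lam t) u) (clos t u)
  /-- `t[x/u] → t` if `x ∉ fv t` -/
  | gc (t u) : 0 ∉ fv t → SubRule (clos t u) (unshift t)
  /-- `C⟨x⟩[x/u] → C⟨u⟩[x/u]`, where `C` captures neither `x` nor the free variables of `u` -/
  | r (C : Ctx) (u) : SubRule (clos (C.fill (var 0)) u) (clos (C.fill (shift u)) u)

/-- One step of the `λ_sub`-calculus. -/
def SubStep : Term → Term → Prop := Compat SubRule

/-! ### The calculus with local substitutions -/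

/-- The equation `t[x/u][y/v] = t[y/v][x/u]` if `y ∉ fv u` and `x ∉ fv v`
(the second condition holds by construction). -/
inductive CRule : Term → Term → Prop
  | c (t u v) : 0 ∉ fv u →
      CRule (clos (clos t u) v) (clos (clos (swap t) (shift v)) (unshift u))

/-- The congruence generated by the equation `C` (and `α`-conversion). -/
def EsEq : Term → Term → Prop := Relation.EqvGen (Compat CRule)

/-- The rules `App₁`, `App₂`, `App₃`, `Lamb`, `Comp₁`, `Comp₂`. -/
inductive AlcRule : Term → Term → Prop
  /-- `(t u)[x/v] → t[x/v] u[x/v]` if `x ∈ fv t` and `x ∈ fv u` -/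
  | app₁ (t u v) : 0 ∈ fv t → 0 ∈ fv u →
      AlcRule (clos (app t u) v) (app (clos t v) (clos u v))
  /-- `(t u)[x/v] → t u[x/v]` if `x ∉ fv t` and `x ∈ fv u` -/
  | app₂ (t u v) : 0 ∉ fv t → 0 ∈ fv u →
      AlcRule (clos (app t u) v) (app (unshift t) (clos u v))
  /-- `(t u)[x/v] → t[x/v] u` if `x ∈ fv t` and `x ∉ fv u` -/
  | app₃ (t u v) : 0 ∈ fv t → 0 ∉ fv u →
      AlcRule (clos (app t u) v) (app (clos t v) (unshift u))
  /-- `(λ y. t)[x/v] → λ y. t[x/v]` -/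
  | lamb (t v) : AlcRule (clos (lam t) v) (lam (clos (swap t) (shift v)))
  /-- `t[x/u][y/v] → t[y/v][x/u[y/v]]` if `y ∈ fv u` and `y ∈ fv t` -/
  | comp₁ (t u v) : 0 ∈ fv u → 1 ∈ fv t →
      AlcRule (clos (clos t u) v) (clos (clos (swap t) (shift v)) (clos u v))
  /-- `t[x/u][y/v] → t[x/u[y/v]]` if `y ∈ fv u` and `y ∉ fv t` -/
  | comp₂ (t u v) : 0 ∈ fv u → 1 ∉ fv t →
      AlcRule (clos (clos t u) v) (clos (unshift (swap t)) (clos u v))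

/-- The rules `B`, `Var`, `Gc` together with the six previous ones. -/
inductive BsRule : Term → Term → Prop
  /-- `(λ x. t) u → t[x/u]` -/
  | b (t u) : BsRule (app (lam t) u) (clos t u)
  /-- `x[x/u] → u` -/
  | var (u) : BsRule (clos (var 0) u) u
  /-- `t[x/u] → t` if `x ∉ fv t` -/
  | gc (t u) : 0 ∉ fv t → BsRule (clos t u) (unshift t)
  | alc {t t'} : AlcRule t t' → BsRule t t'

/-- Rewriting with a set of rules, closed under all contexts, modulo the congruence `EsEq`. -/
def StepMod (R : Term → Term → Prop) (t t' : Term) : Prop :=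
  ∃ s s', EsEq t s ∧ Compat R s s' ∧ EsEq s' t'

/-- One step of the `ALC` reduction. -/
def AlcStep : Term → Term → Prop := StepMod AlcRule

/-- One step of the `λes`-calculus. -/
def EsStep : Term → Term → Prop := StepMod BsRule

/-! ### Normal forms and the translation -/

/-- `ALC`-normal terms. -/
def AlcNormal (t : Term) : Prop := ∀ t', ¬ AlcStep t t'

/-- `s` is an `ALC`-normal form of `t`: it is normal, and `t` reduces to `s` in some number of
steps, zero steps meaning equality modulo `EsEq`. -/
def IsAlcNormalForm (t s : Term) : Prop :=
  (EsEq t s ∨ Relation.TransGen AlcStep t s) ∧ AlcNormal s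

open Classical in
/-- A function choosing an `ALC`-normal form of every term that has one. -/
noncomputable def alc (t : Term) : Term :=
  if h : ∃ s, IsAlcNormalForm t s then h.choose else t

open Classical in
/-- The translation `T`, with `z` fresh:
`T(x) = x`, `T(λ x. t) = λ x. T(t)`, `T(t u) = (T(t) T(u))[z/T(u)]`,
`T(t[y/u]) = ALC(T(t)[y/T(u)][z/T(u)])` if `y ∈ fv t`, and
`T(t[y/u]) = ALC(T(t)[y/T(u)])` if `y ∉ fv t`. -/
noncomputable def tra : Term → Term
  | var n => var n
  | lam t => lam (tra t)
  | app t u => clos (shift (app (tra t) (tra u))) (tra u)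
  | clos t u =>
      if 0 ∈ fv t then alc (clos (shift (clos (tra t) (tra u))) (tra u))
      else alc (clos (tra t) (tra u))

end LambdaSub

/-! `ALC` reduction distributes a closure until nothing can move, and the outcome can be written
down directly. If `x` occurs in `t`, the normal form of `t[x/v]` (`t`, `v` normal) replaces every
occurrence of `x` by `x[x/v]`; this is `psub`. If `x` does not occur, the closure is garbage: the
only rule moving it through a normal `t` is `Lamb`, so it stops below the leading abstractions; this
is `gins`. Combining the two gives a structurally recursive `nf`.

Uniqueness needs no termination or confluence argument. Each term reduces to its `nf` (`red_nf`),
and both the congruence and the `ALC` steps preserve `nf` modulo `EsEq` (`EsEq.nf`,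
`AlcStep.nf_esEq`). A normal term is therefore `EsEq` to its own `nf`, hence to that of any term it
comes from. Normality of `nf` follows from a syntactic predicate `NF`, invariant under the
congruence and incompatible with any `ALC` redex.

Uniqueness makes the choice function harmless: `tra` agrees modulo `EsEq` with the recursive `tr`,
whose closure clause is the same whether or not the variable occurs (`tra_esEq_tr`). In `tr`, every
argument of an application or closure leaves a garbage copy, so a step inside an argument is never
lost, even when the bound variable does not occur. For the root rules: `B` gives a closure that
`ALC` distributes; `Gc` erases the garbage copy; and for partial substitution the selected `x` has
become `x[x/v]`, which `Var` turns into `v` (`esPlus_tr_fill`). -/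

namespace LambdaSub

open Term Relation

namespace Term

/-! ### Simultaneous substitution -/

/-- Extend a substitution under a binder. -/
def up (σ : ℕ → Term) : ℕ → Term
  | 0 => var 0
  | n + 1 => shift (σ n)

/-- Capture-avoiding simultaneous substitution. -/
def subst : (ℕ → Term) → Term → Term
  | σ, var n => σ n
  | σ, app t u => app (subst σ t) (subst σ u)
  | σ, lam t => lam (subst (up σ) t)
  | σ, clos t u => clos (subst (up σ) t) (subst σ u)

@[simp] theorem up_zero (σ : ℕ → Term) : up σ 0 = var 0 := rfl
@[simp] theorem up_succ (σ : ℕ → Term) (n : ℕ) : up σ (n + 1) = shift (σ n) := rfl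
@[simp] theorem liftRen_zero (ρ : ℕ → ℕ) : liftRen ρ 0 = 0 := rfl
@[simp] theorem liftRen_succ (ρ : ℕ → ℕ) (n : ℕ) : liftRen ρ (n + 1) = ρ n + 1 := rfl

theorem rename_rename (t : Term) : ∀ ρ ρ' : ℕ → ℕ,
    rename ρ (rename ρ' t) = rename (ρ ∘ ρ') t := by
  have key : ∀ ρ ρ' : ℕ → ℕ, liftRen ρ ∘ liftRen ρ' = liftRen (ρ ∘ ρ') := by
    intro ρ ρ'; funext n; cases n <;> rfl
  induction t with
  | var n => intros; rfl
  | app t u iht ihu => intros; simp only [rename, iht, ihu]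
  | lam t ih => intros; simp only [rename, ih, key]
  | clos t u iht ihu => intros; simp only [rename, iht, ihu, key]

theorem rename_shift (ρ : ℕ → ℕ) (t : Term) :
    rename (liftRen ρ) (shift t) = shift (rename ρ t) := by
  simp only [shift, rename_rename]
  rfl

theorem rename_eq_subst (t : Term) : ∀ ρ : ℕ → ℕ,
    rename ρ t = subst (fun n => var (ρ n)) t := by
  have key : ∀ ρ : ℕ → ℕ, up (fun n => var (ρ n)) = fun n => var (liftRen ρ n) := by
    intro ρ; funext n; cases n <;> rfl
  induction t with
  | var n => intros; rfl
  | app t u iht ihu => intros; simp only [rename, subst, iht, ihu]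
  | lam t ih => intros; simp only [rename, subst, ih, key]
  | clos t u iht ihu => intros; simp only [rename, subst, iht, ihu, key]

theorem subst_rename (t : Term) : ∀ (σ : ℕ → Term) (ρ : ℕ → ℕ),
    subst σ (rename ρ t) = subst (fun n => σ (ρ n)) t := by
  have key : ∀ (σ : ℕ → Term) (ρ : ℕ → ℕ),
      (fun n => up σ (liftRen ρ n)) = up (fun n => σ (ρ n)) := by
    intro σ ρ; funext n; cases n <;> rfl
  induction t with
  | var n => intros; rfl
  | app t u iht ihu => intros; simp only [rename, subst, iht, ihu]
  | lam t ih => intros; simp only [rename, subst, ih, key]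
  | clos t u iht ihu => intros; simp only [rename, subst, iht, ihu, key]

theorem rename_subst (t : Term) : ∀ (ρ : ℕ → ℕ) (σ : ℕ → Term),
    rename ρ (subst σ t) = subst (fun n => rename ρ (σ n)) t := by
  have key : ∀ (ρ : ℕ → ℕ) (σ : ℕ → Term),
      (fun n => rename (liftRen ρ) (up σ n)) = up (fun n => rename ρ (σ n)) := by
    intro ρ σ; funext n
    cases n with
    | zero => rfl
    | succ n => exact rename_shift _ _
  induction t with
  | var n => intros; rfl
  | app t u iht ihu => intros; simp only [rename, subst, iht, ihu]
  | lam t ih => intros; simp only [rename, subst, ih, key]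
  | clos t u iht ihu => intros; simp only [rename, subst, iht, ihu, key]

theorem subst_shift (σ : ℕ → Term) (t : Term) :
    subst (up σ) (shift t) = shift (subst σ t) := by
  simp only [shift, subst_rename, rename_subst]
  rfl

theorem subst_subst (t : Term) : ∀ σ τ : ℕ → Term,
    subst σ (subst τ t) = subst (fun n => subst σ (τ n)) t := by
  have key : ∀ σ τ : ℕ → Term,
      (fun n => subst (up σ) (up τ n)) = up (fun n => subst σ (τ n)) := by
    intro σ τ; funext n
    cases n with
    | zero => rfl
    | succ n => exact subst_shift _ _
  induction t with
  | var n => intros; rfl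
  | app t u iht ihu => intros; simp only [subst, iht, ihu]
  | lam t ih => intros; simp only [subst, ih, key]
  | clos t u iht ihu => intros; simp only [subst, iht, ihu, key]

/-- Needed because `unshift` gives index `0` a junk value, harmless exactly when that index is not
free. -/
theorem subst_congr (t : Term) : ∀ {σ τ : ℕ → Term}, (∀ n ∈ fv t, σ n = τ n) →
    subst σ t = subst τ t := by
  have key : ∀ {σ τ : ℕ → Term} {s : Set ℕ}, (∀ n, n + 1 ∈ s → σ n = τ n) →
      ∀ n ∈ s, up σ n = up τ n := by
    intro σ τ s h n hn
    cases n with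
    | zero => rfl
    | succ n => simp only [up_succ, h n hn]
  induction t with
  | var n => intro σ τ h; exact h n rfl
  | app t u iht ihu =>
    intro σ τ h
    simp only [subst, iht fun n hn => h n (Or.inl hn), ihu fun n hn => h n (Or.inr hn)]
  | lam t ih => intro σ τ h; simp only [subst, ih (key h)]
  | clos t u iht ihu =>
    intro σ τ h
    simp only [subst, iht (key fun n hn => h n (Or.inl hn)), ihu fun n hn => h n (Or.inr hn)]

theorem subst_var (t : Term) : subst var t = t := by
  have key : up var = var := by funext n; cases n <;> rfl
  induction t with
  | var n => rfl
  | app t u iht ihu => simp only [subst, iht, ihu]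
  | lam t ih => simp only [subst, key, ih]
  | clos t u iht ihu => simp only [subst, key, iht, ihu]

theorem subst_eq_self {t : Term} {σ : ℕ → Term} (h : ∀ n ∈ fv t, σ n = var n) :
    subst σ t = t := (subst_congr t h).trans (subst_var t)

theorem mem_fv_rename (t : Term) : ∀ {ρ : ℕ → ℕ} {m : ℕ},
    m ∈ fv (rename ρ t) ↔ ∃ n ∈ fv t, ρ n = m := by
  have key : ∀ {ρ : ℕ → ℕ} {s : Set ℕ} {m : ℕ},
      (∃ n ∈ s, liftRen ρ n = m + 1) ↔ ∃ n, n + 1 ∈ s ∧ ρ n = m := by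
    intro ρ s m
    constructor
    · rintro ⟨n, hn, e⟩
      cases n with
      | zero => simp at e
      | succ n => exact ⟨n, hn, by simpa using e⟩
    · rintro ⟨n, hn, e⟩
      exact ⟨n + 1, hn, by simpa using e⟩
  induction t with
  | var n => intro ρ m; simp [rename, fv, eq_comm]
  | app t u iht ihu =>
    intro ρ m
    simp only [rename, fv, Set.mem_union, iht, ihu, or_and_right, exists_or]
  | lam t ih => intro ρ m; simp only [rename, fv, Set.mem_ofPred_eq, ih, key]
  | clos t u iht ihu =>
    intro ρ m
    simp only [rename, fv, Set.mem_union, Set.mem_ofPred_eq, iht, ihu, key, or_and_right, exists_or]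

theorem succ_mem_fv_shift {t : Term} {n : ℕ} : n + 1 ∈ fv (shift t) ↔ n ∈ fv t := by
  simp [shift, mem_fv_rename]

theorem zero_notMem_fv_shift (t : Term) : 0 ∉ fv (shift t) := by
  simp [shift, mem_fv_rename]

theorem mem_fv_subst (t : Term) : ∀ {σ : ℕ → Term} {m : ℕ},
    m ∈ fv (subst σ t) ↔ ∃ n ∈ fv t, m ∈ fv (σ n) := by
  have key : ∀ {σ : ℕ → Term} {s : Set ℕ} {m : ℕ},
      (∃ n ∈ s, m + 1 ∈ fv (up σ n)) ↔ ∃ n, n + 1 ∈ s ∧ m ∈ fv (σ n) := by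
    intro σ s m
    constructor
    · rintro ⟨n, hn, e⟩
      cases n with
      | zero => simp [fv] at e
      | succ n => exact ⟨n, hn, succ_mem_fv_shift.1 e⟩
    · rintro ⟨n, hn, e⟩
      exact ⟨n + 1, hn, succ_mem_fv_shift.2 e⟩
  induction t with
  | var n => intro σ m; simp [subst, fv]
  | app t u iht ihu =>
    intro ρ m
    simp only [subst, fv, Set.mem_union, iht, ihu, or_and_right, exists_or]
  | lam t ih => intro ρ m; simp only [subst, fv, Set.mem_ofPred_eq, ih, key]
  | clos t u iht ihu =>
    intro ρ m
    simp only [subst, fv, Set.mem_union, Set.mem_ofPred_eq, iht, ihu, key, or_and_right, exists_or]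

theorem zero_mem_fv_subst_up {t : Term} {σ : ℕ → Term} :
    0 ∈ fv (subst (up σ) t) ↔ 0 ∈ fv t := by
  rw [mem_fv_subst]
  constructor
  · rintro ⟨n, hn, h⟩
    cases n with
    | zero => exact hn
    | succ n => exact absurd h (zero_notMem_fv_shift _)
  · exact fun h => ⟨0, h, rfl⟩

theorem one_mem_fv_subst_up_up {t : Term} {σ : ℕ → Term} :
    1 ∈ fv (subst (up (up σ)) t) ↔ 1 ∈ fv t := by
  rw [mem_fv_subst]
  constructor
  · rintro ⟨n, hn, h⟩
    match n with
    | 0 => simp [fv] at h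
    | 1 => exact hn
    | n + 2 => exact absurd (succ_mem_fv_shift.1 h) (zero_notMem_fv_shift _)
  · exact fun h => ⟨1, h, rfl⟩

/-! ### Rearranging binders -/

/-- The transposition of the indices `0` and `1`. -/
def swapIdx (n : ℕ) : ℕ :=
  match n with
  | 0 => 1
  | 1 => 0
  | k + 2 => k + 2

@[simp] theorem swapIdx_zero : swapIdx 0 = 1 := rfl
@[simp] theorem swapIdx_one : swapIdx 1 = 0 := rfl
@[simp] theorem swapIdx_add_two (n : ℕ) : swapIdx (n + 2) = n + 2 := rfl

theorem swap_eq (t : Term) : swap t = rename swapIdx t := rfl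

theorem mem_fv_swap {t : Term} {n : ℕ} : n ∈ fv (swap t) ↔ swapIdx n ∈ fv t := by
  have inv : ∀ m, swapIdx (swapIdx m) = m := by
    intro m
    match m with
    | 0 => rfl
    | 1 => rfl
    | m + 2 => rfl
  rw [swap_eq, mem_fv_rename]
  constructor
  · rintro ⟨m, hm, rfl⟩
    rwa [inv]
  · exact fun h => ⟨_, h, inv n⟩

theorem subst_swap (σ : ℕ → Term) (t : Term) :
    subst (up (up σ)) (swap t) = swap (subst (up (up σ)) t) := by
  simp only [swap_eq, subst_rename, rename_subst]
  congr 1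
  funext n
  match n with
  | 0 => rfl
  | 1 => rfl
  | n + 2 =>
    simp only [swapIdx_add_two, up_succ, shift, rename_rename]
    rfl

theorem unshift_shift (t : Term) : unshift (shift t) = t := by
  rw [shift, unshift, rename_rename, rename_eq_subst]
  exact subst_var t

theorem subst_unshift {t : Term} (h : 0 ∉ fv t) (σ : ℕ → Term) :
    subst σ (unshift t) = unshift (subst (up σ) t) := by
  simp only [unshift, subst_rename, rename_subst]
  -- The two substitutions disagree only at index `0`, where `Nat.pred 0 = 0`; `h` rules this index
  -- out.
  refine subst_congr t fun n hn => ?_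
  cases n with
  | zero => exact absurd hn h
  | succ n => exact (unshift_shift _).symm

theorem mem_fv_unshift {t : Term} (h : 0 ∉ fv t) {n : ℕ} : n ∈ fv (unshift t) ↔ n + 1 ∈ fv t := by
  rw [unshift, mem_fv_rename]
  constructor
  · rintro ⟨m, hm, rfl⟩
    cases m with
    | zero => exact absurd hm h
    | succ m => exact hm
  · exact fun h => ⟨_, h, rfl⟩

/-! ### Replacing a variable by itself under a closure -/

/-- The substitution `x ↦ x[x/v]`, for `x` the innermost variable. -/
def inst (v : Term) : ℕ → Term
  | 0 => clos (var 0) v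
  | n + 1 => var n

/-- `t` with every occurrence of the innermost variable `x` replaced by `x[x/v]`. -/
def psub (t v : Term) : Term := subst (inst v) t

@[simp] theorem inst_zero (v : Term) : inst v 0 = clos (var 0) v := rfl
@[simp] theorem inst_succ (v : Term) (n : ℕ) : inst v (n + 1) = var n := rfl

theorem psub_shift (t v : Term) : psub (shift t) v = t := by
  simp only [psub, shift, subst_rename]
  exact subst_var t

theorem subst_psub (σ : ℕ → Term) (t v : Term) :
    subst σ (psub t v) = psub (subst (up σ) t) (subst σ v) := by
  simp only [psub, subst_subst]
  congr 1
  funext n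
  cases n with
  | zero => rfl
  | succ n => exact (psub_shift _ _).symm

/-- Rules with side conditions drop a binder where the others distribute a closure; reading the drop
as a vacuous `psub` lets one identity treat all of them. -/
theorem psub_eq_unshift {t : Term} (h : 0 ∉ fv t) (v : Term) : psub t v = unshift t := by
  rw [psub, unshift, rename_eq_subst]
  refine subst_congr t fun n hn => ?_
  cases n with
  | zero => exact absurd hn h
  | succ n => rfl

theorem shift_unshift {t : Term} (h : 0 ∉ fv t) : shift (unshift t) = t := by
  rw [shift, unshift, rename_rename, rename_eq_subst]
  refine subst_eq_self fun n hn => ?_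
  cases n with
  | zero => exact absurd hn h
  | succ n => rfl

/-- The identity behind equation `C` and both `Comp` rules: either side sends `x` to `x[x/u']`, with
`u'` equal to `psub u v`, and `y` to `y[y/v]`. -/
theorem psub_psub_swap (t u v : Term) :
    psub (psub (swap t) (shift v)) (psub u v) = psub (psub t u) v := by
  simp only [psub, swap_eq, subst_rename, subst_subst]
  congr 1
  funext n
  match n with
  | 0 => rfl
  | 1 =>
    simp only [swapIdx_one, inst_zero, subst, up_zero, inst_succ]
    exact congrArg _ (psub_shift v _)
  | n + 2 => rfl

theorem mem_fv_psub {t v : Term} {n : ℕ} :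
    n ∈ fv (psub t v) ↔ n + 1 ∈ fv t ∨ 0 ∈ fv t ∧ n ∈ fv v := by
  rw [psub, mem_fv_subst]
  constructor
  · rintro ⟨m, hm, h⟩
    cases m with
    | zero => exact Or.inr ⟨hm, by simpa [fv] using h⟩
    | succ m =>
      obtain rfl : n = m := h
      exact Or.inl hm
  · rintro (h | ⟨h, h'⟩)
    · exact ⟨_, h, rfl⟩
    · exact ⟨0, h, Or.inr h'⟩

theorem psub_swap_lam (t v : Term) :
    psub (lam t) v = lam (psub (swap t) (shift v)) := by
  simp only [psub, subst, swap_eq, subst_rename]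
  congr 2
  funext n
  match n with
  | 0 => rfl
  | 1 => rfl
  | n + 2 => rfl

theorem psub_clos (t u v : Term) :
    psub (clos t u) v = clos (psub (swap t) (shift v)) (psub u v) := by
  have h := psub_swap_lam t v
  simp only [psub, subst, lam.injEq] at h ⊢
  rw [h]

/-! ### Garbage closures and leading abstractions -/

/-- Terms that are not abstractions. -/
def NotLam (t : Term) : Prop := ∀ s, t ≠ lam s

theorem NotLam.rename {t : Term} (h : NotLam t) (ρ : ℕ → ℕ) : NotLam (rename ρ t) := by
  cases t with
  | lam t => exact absurd rfl (h t)
  | _ => intro s hs; simp [Term.rename] at hs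

theorem notLam_up {σ : ℕ → Term} (h : ∀ n, NotLam (σ n)) (n : ℕ) : NotLam (up σ n) := by
  cases n with
  | zero => intro s hs; simp at hs
  | succ n => exact (h n).rename _

theorem notLam_inst (v : Term) (n : ℕ) : NotLam (inst v n) := by
  cases n <;> intro s hs <;> simp at hs

theorem NotLam.subst {t : Term} (h : NotLam t) {σ : ℕ → Term} (hσ : ∀ n, NotLam (σ n)) :
    NotLam (subst σ t) := by
  cases t with
  | lam t => exact absurd rfl (h t)
  | var n => exact hσ n
  | _ => intro s hs; simp [Term.subst] at hs

/-- `t[x/v]`, for `x` not free in `t`, with the closure moved below the leading abstractions. -/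
def gins : Term → Term → Term
  | lam t, v => lam (gins t (shift v))
  | var n, v => clos (shift (var n)) v
  | app t u, v => clos (shift (app t u)) v
  | clos t u, v => clos (shift (clos t u)) v

theorem gins_of_notLam {t : Term} (h : NotLam t) (v : Term) : gins t v = clos (shift t) v := by
  cases t with
  | lam t => exact absurd rfl (h t)
  | _ => rfl

/-- If an abstraction were substituted for the variable where the closure stops, the closure could
sink further; this is why `NotLam` values are required. -/
theorem subst_gins (t : Term) : ∀ {σ : ℕ → Term}, (∀ n, NotLam (σ n)) → ∀ v : Term,
    subst σ (gins t v) = gins (subst σ t) (subst σ v) := by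
  have key : ∀ {t : Term}, NotLam t → ∀ {σ : ℕ → Term}, (∀ n, NotLam (σ n)) → ∀ v : Term,
      subst σ (gins t v) = gins (subst σ t) (subst σ v) := by
    intro t h σ hσ v
    rw [gins_of_notLam h, gins_of_notLam (h.subst hσ), subst, subst_shift]
  induction t with
  | lam t ih =>
    intro σ hσ v
    simp only [gins, subst, ih (notLam_up hσ), subst_shift]
  | _ => exact key (by intro s hs; simp at hs)

theorem mem_fv_gins (t : Term) : ∀ {v : Term} {n : ℕ},
    n ∈ fv (gins t v) ↔ n ∈ fv t ∨ n ∈ fv v := by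
  have key : ∀ {t : Term}, NotLam t → ∀ {v : Term} {n : ℕ},
      n ∈ fv (gins t v) ↔ n ∈ fv t ∨ n ∈ fv v := by
    intro t h v n
    rw [gins_of_notLam h]
    simp only [fv, Set.mem_union, Set.mem_ofPred_eq, succ_mem_fv_shift]
  induction t with
  | lam t ih =>
    intro v n
    simp only [gins, fv, Set.mem_ofPred_eq, ih, succ_mem_fv_shift]
  | _ => exact key (by intro s hs; simp at hs)

/-- The number of constructors. -/
def size : Term → ℕ
  | var _ => 1
  | app t u => size t + size u + 1
  | lam t => size t + 1
  | clos t u => size t + size u + 1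

theorem size_rename (t : Term) : ∀ ρ : ℕ → ℕ, size (rename ρ t) = size t := by
  induction t with
  | var n => intros; rfl
  | app t u iht ihu => intros; simp only [rename, size, iht, ihu]
  | lam t ih => intros; simp only [rename, size, ih]
  | clos t u iht ihu => intros; simp only [rename, size, iht, ihu]

end Term
/-! ### The congruence and rewriting modulo it -/

/-- Relations stable under substitution. -/
def SubstClosed (R : Term → Term → Prop) : Prop :=
  ∀ ⦃t t' : Term⦄, R t t' → ∀ σ : ℕ → Term, R (subst σ t) (subst σ t')

theorem Compat.subst {R : Term → Term → Prop} (hR : SubstClosed R) : SubstClosed (Compat R) := by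
  intro t t' h
  induction h with
  | root h => exact fun σ => .root (hR h σ)
  | appL u _ ih => exact fun σ => .appL _ (ih σ)
  | appR t _ ih => exact fun σ => .appR _ (ih σ)
  | lam _ ih => exact fun σ => .lam (ih _)
  | closL u _ ih => exact fun σ => .closL _ (ih _)
  | closR t _ ih => exact fun σ => .closR _ (ih σ)

theorem Compat.mono {R S : Term → Term → Prop} (hRS : ∀ t t', R t t' → S t t') {t t' : Term}
    (h : Compat R t t') : Compat S t t' := by
  induction h with
  | root h => exact .root (hRS _ _ h)
  | appL u _ ih => exact .appL _ ih
  | appR t _ ih => exact .appR _ ih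
  | lam _ ih => exact .lam ih
  | closL u _ ih => exact .closL _ ih
  | closR t _ ih => exact .closR _ ih

theorem Compat.symm {R : Term → Term → Prop} (hR : ∀ t t', R t t' → R t' t) {t t' : Term}
    (h : Compat R t t') : Compat R t' t := by
  induction h with
  | root h => exact .root (hR _ _ h)
  | appL u _ ih => exact .appL _ ih
  | appR t _ ih => exact .appR _ ih
  | lam _ ih => exact .lam ih
  | closL u _ ih => exact .closL _ ih
  | closR t _ ih => exact .closR _ ih

theorem Compat.mem_fv_iff {R : Term → Term → Prop}
    (hR : ∀ t t', R t t' → ∀ n, n ∈ fv t ↔ n ∈ fv t') {t t' : Term} (h : Compat R t t') :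
    ∀ n, n ∈ fv t ↔ n ∈ fv t' := by
  induction h with
  | root h => exact hR _ _ h
  | appL u _ ih => intro n; simp only [fv, Set.mem_union, ih]
  | appR t _ ih => intro n; simp only [fv, Set.mem_union, ih]
  | lam _ ih => intro n; simp only [fv, Set.mem_ofPred_eq, ih]
  | closL u _ ih => intro n; simp only [fv, Set.mem_union, Set.mem_ofPred_eq, ih]
  | closR t _ ih => intro n; simp only [fv, Set.mem_union, Set.mem_ofPred_eq, ih]

theorem CRule.subst : SubstClosed CRule := by
  intro t t' h σ
  cases h with
  | c t u v h =>
    simp only [Term.subst, subst_swap, subst_shift, subst_unshift h]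
    exact .c _ _ _ (by rwa [zero_mem_fv_subst_up])

theorem CRule.mem_fv_iff (t t' : Term) (h : CRule t t') (n : ℕ) : n ∈ fv t ↔ n ∈ fv t' := by
  cases h with
  | c t u v h =>
    simp only [fv, Set.mem_union, Set.mem_ofPred_eq, mem_fv_swap, succ_mem_fv_shift,
      mem_fv_unshift h, swapIdx_add_two]
    tauto

theorem CRule.symm (t t' : Term) (h : CRule t t') : CRule t' t := by
  cases h with
  | c t u v h =>
    have hs : swap (swap t) = t := by
      rw [swap_eq, swap_eq, rename_rename, rename_eq_subst]
      refine subst_eq_self fun n _ => ?_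
      match n with
      | 0 => rfl
      | 1 => rfl
      | n + 2 => rfl
    have := CRule.c (swap t) (shift v) (unshift u) (zero_notMem_fv_shift v)
    rwa [hs, shift_unshift h, unshift_shift] at this

theorem EsEq.refl (t : Term) : EsEq t t := EqvGen.refl t

theorem EsEq.symm {t u : Term} (h : EsEq t u) : EsEq u t := EqvGen.symm _ _ h

theorem EsEq.trans {t u v : Term} (h : EsEq t u) (h' : EsEq u v) : EsEq t v :=
  EqvGen.trans _ _ _ h h'

theorem EsEq.of_compat {t u : Term} (h : Compat CRule t u) : EsEq t u := EqvGen.rel _ _ h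

theorem EsEq.of_crule {t u : Term} (h : CRule t u) : EsEq t u := .of_compat (.root h)

theorem EsEq.map {f : Term → Term} (hf : ∀ t t', Compat CRule t t' → EsEq (f t) (f t'))
    {t t' : Term} (h : EsEq t t') : EsEq (f t) (f t') := by
  induction h with
  | rel _ _ h => exact hf _ _ h
  | refl _ => exact .refl _
  | symm _ _ _ ih => exact ih.symm
  | trans _ _ _ _ _ ih ih' => exact ih.trans ih'

theorem EsEq.app {t t' u u' : Term} (ht : EsEq t t') (hu : EsEq u u') :
    EsEq (app t u) (app t' u') :=
  (ht.map (f := fun t => Term.app t u) fun _ _ h => .of_compat (.appL _ h)).trans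
    (hu.map fun _ _ h => .of_compat (.appR _ h))

theorem EsEq.lam {t t' : Term} (ht : EsEq t t') : EsEq (lam t) (lam t') :=
  ht.map fun _ _ h => .of_compat (.lam h)

theorem EsEq.clos {t t' u u' : Term} (ht : EsEq t t') (hu : EsEq u u') :
    EsEq (clos t u) (clos t' u') :=
  (ht.map (f := fun t => Term.clos t u) fun _ _ h => .of_compat (.closL _ h)).trans
    (hu.map fun _ _ h => .of_compat (.closR _ h))

theorem EsEq.subst : SubstClosed EsEq := fun _ _ h σ =>
  h.map fun _ _ h => .of_compat (Compat.subst CRule.subst h σ)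

theorem EsEq.rename {t t' : Term} (h : EsEq t t') (ρ : ℕ → ℕ) :
    EsEq (rename ρ t) (rename ρ t') := by
  rw [rename_eq_subst, rename_eq_subst]
  exact EsEq.subst h _

theorem EsEq.psub {t t' v v' : Term} (ht : EsEq t t') (hv : EsEq v v') :
    EsEq (psub t v) (psub t' v') := by
  have key : ∀ (t : Term) {σ τ : ℕ → Term}, (∀ n, EsEq (σ n) (τ n)) →
      EsEq (Term.subst σ t) (Term.subst τ t) := by
    have hup : ∀ {σ τ : ℕ → Term}, (∀ n, EsEq (σ n) (τ n)) → ∀ n, EsEq (up σ n) (up τ n) := by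
      intro σ τ h n
      cases n with
      | zero => exact .refl _
      | succ n => exact (h n).rename _
    intro t
    induction t with
    | var n => exact fun h => h n
    | app t u iht ihu => exact fun h => (iht h).app (ihu h)
    | lam t ih => exact fun h => (ih (hup h)).lam
    | clos t u iht ihu => exact fun h => (iht (hup h)).clos (ihu h)
  refine (EsEq.subst ht _).trans (key _ fun n => ?_)
  cases n with
  | zero => exact (EsEq.refl _).clos hv
  | succ n => exact .refl _

theorem EsEq.gins_right (t : Term) : ∀ {v v' : Term}, EsEq v v' → EsEq (gins t v) (gins t v') := by
  induction t with
  | lam t ih => exact fun hv => (ih (hv.rename _)).lam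
  | _ => exact fun hv => (EsEq.refl _).clos hv

theorem EsEq.gins {t t' v v' : Term} (ht : EsEq t t') (hv : EsEq v v') :
    EsEq (gins t v) (gins t' v') := by
  refine EsEq.trans ?_ (EsEq.gins_right t' hv)
  refine ht.map (f := fun t => Term.gins t v) fun t t' h => ?_
  -- Only a step below a leading abstraction recurses, with `v` shifted; any other step has a
  -- non-abstraction on both sides, where `gins` is a plain closure.
  induction h generalizing v v' with
  | root h => cases h with
    | c t u w h =>
      exact ((EsEq.of_crule (.c t u w h)).rename _).clos (.refl _)
  | lam _ ih => exact (ih (.refl _)).lam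
  | appL u h => exact ((EsEq.of_compat (.appL u h)).rename _).clos (.refl _)
  | appR u h => exact ((EsEq.of_compat (.appR u h)).rename _).clos (.refl _)
  | closL u h => exact ((EsEq.of_compat (.closL u h)).rename _).clos (.refl _)
  | closR u h => exact ((EsEq.of_compat (.closR u h)).rename _).clos (.refl _)

/-- Once below the leading abstractions, two garbage closures sit next to each other and equation
`C` exchanges them. -/
theorem EsEq.gins_gins (t : Term) : ∀ u v : Term,
    EsEq (Term.gins (Term.gins t u) v) (Term.gins (Term.gins t v) u) := by
  have key : ∀ {t : Term}, NotLam t → ∀ u v : Term,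
      EsEq (Term.gins (Term.gins t u) v) (Term.gins (Term.gins t v) u) := by
    intro t h u v
    have hc : ∀ a b : Term, NotLam (Term.clos a b) := by intro a b s hs; simp at hs
    rw [gins_of_notLam h, gins_of_notLam h, gins_of_notLam (hc _ _), gins_of_notLam (hc _ _)]
    have := CRule.c (Term.rename (liftRen Nat.succ) (shift t)) (shift u) v (zero_notMem_fv_shift u)
    refine EsEq.of_crule ?_
    simp only [unshift_shift] at this
    convert this using 2
    change Term.clos _ _ = Term.clos _ _
    congr 1
    simp only [shift, swap_eq, Term.rename, rename_rename]
    rfl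
  induction t with
  | lam t ih => exact fun u v => (ih _ _).lam
  | _ => exact key (by intro s hs; simp at hs)

/-! ### Rewriting modulo the congruence -/

theorem StepMod.of_compat {R : Term → Term → Prop} {t t' : Term} (h : Compat R t t') :
    StepMod R t t' := ⟨_, _, .refl _, h, .refl _⟩

theorem StepMod.map {R S : Term → Term → Prop} {f : Term → Term}
    (he : ∀ t t', EsEq t t' → EsEq (f t) (f t'))
    (hs : ∀ t t', Compat R t t' → Compat S (f t) (f t')) {t t' : Term}
    (h : StepMod R t t') : StepMod S (f t) (f t') := by
  obtain ⟨s, s', h₁, h₂, h₃⟩ := h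
  exact ⟨_, _, he _ _ h₁, hs _ _ h₂, he _ _ h₃⟩

/-- Reduction in any number of steps, zero steps meaning equality modulo `EsEq`. -/
def Red (R : Term → Term → Prop) (t s : Term) : Prop :=
  EsEq t s ∨ TransGen (StepMod R) t s

theorem EsEq.trans_plus {R : Term → Term → Prop} {t u v : Term} (h : EsEq t u)
    (h' : TransGen (StepMod R) u v) : TransGen (StepMod R) t v := by
  obtain ⟨w, ⟨s, s', h₁, h₂, h₃⟩, hw⟩ := TransGen.head'_iff.1 h'
  exact TransGen.head'_iff.2 ⟨w, ⟨s, s', h.trans h₁, h₂, h₃⟩, hw⟩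

theorem plus_trans_esEq {R : Term → Term → Prop} {t u v : Term}
    (h' : TransGen (StepMod R) t u) (h : EsEq u v) : TransGen (StepMod R) t v := by
  obtain ⟨w, hw, s, s', h₁, h₂, h₃⟩ := TransGen.tail'_iff.1 h'
  exact TransGen.tail'_iff.2 ⟨w, hw, s, s', h₁, h₂, h₃.trans h⟩

namespace Red

variable {R : Term → Term → Prop} {t u v : Term}

theorem refl (t : Term) : Red R t t := Or.inl (.refl t)

theorem of_rule (h : R t u) : Red R t u := Or.inr (.single (.of_compat (.root h)))

theorem plus_trans (h : TransGen (StepMod R) t u) (h' : Red R u v) : TransGen (StepMod R) t v :=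
  h'.elim (plus_trans_esEq h) h.trans

theorem trans_plus (h : Red R t u) (h' : TransGen (StepMod R) u v) : TransGen (StepMod R) t v :=
  h.elim (fun h => h.trans_plus h') fun h => h.trans h'

theorem trans (h : Red R t u) (h' : Red R u v) : Red R t v :=
  h'.elim (fun e => h.elim (fun e' => Or.inl (e'.trans e)) fun h => Or.inr (plus_trans_esEq h e))
    fun p => Or.inr (h.trans_plus p)

theorem map {S : Term → Term → Prop} {f : Term → Term}
    (he : ∀ t t', EsEq t t' → EsEq (f t) (f t'))
    (hs : ∀ t t', Compat R t t' → Compat S (f t) (f t'))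
    (h : Red R t u) : Red S (f t) (f u) :=
  h.imp (he _ _) (TransGen.lift f (fun _ _ => StepMod.map he hs) _ _)

theorem app {t' u' : Term} (ht : Red R t t') (hu : Red R u u') :
    Red R (app t u) (app t' u') :=
  (ht.map (f := fun t => Term.app t u) (fun _ _ h => h.app (.refl _)) fun _ _ => .appL _).trans
    (hu.map (fun _ _ => (EsEq.refl _).app) fun _ _ => .appR _)

theorem lam (ht : Red R t u) : Red R (lam t) (lam u) :=
  ht.map (fun _ _ => .lam) fun _ _ => .lam

theorem clos {t' u' : Term} (ht : Red R t t') (hu : Red R u u') :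
    Red R (clos t u) (clos t' u') :=
  (ht.map (f := fun t => Term.clos t u) (fun _ _ h => h.clos (.refl _)) fun _ _ => .closL _).trans
    (hu.map (fun _ _ => (EsEq.refl _).clos) fun _ _ => .closR _)

theorem subst (hR : SubstClosed R) (h : Red R t u) (σ : ℕ → Term) :
    Red R (subst σ t) (subst σ u) :=
  h.map (fun _ _ h => EsEq.subst h σ) fun _ _ h => Compat.subst hR h σ

end Red
/-! ### Computing `ALC`-normal forms -/

/-- `ALC` rules never erase a closure. Since `nf` branches on whether the bound variable occurs,
this keeps the branch unchanged by a step in the body. -/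
theorem AlcRule.mem_fv_iff (t t' : Term) (h : AlcRule t t') (n : ℕ) : n ∈ fv t ↔ n ∈ fv t' := by
  cases h with
  | app₁ t u v h h' => simp only [fv, Set.mem_union, Set.mem_ofPred_eq]; tauto
  | app₂ t u v h h' =>
    simp only [fv, Set.mem_union, Set.mem_ofPred_eq, mem_fv_unshift h]; tauto
  | app₃ t u v h h' =>
    simp only [fv, Set.mem_union, Set.mem_ofPred_eq, mem_fv_unshift h']; tauto
  | lamb t v =>
    simp only [fv, Set.mem_union, Set.mem_ofPred_eq, mem_fv_swap, succ_mem_fv_shift,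
      swapIdx_add_two]
  | comp₁ t u v h h' =>
    simp only [fv, Set.mem_union, Set.mem_ofPred_eq, mem_fv_swap, succ_mem_fv_shift,
      swapIdx_add_two]
    tauto
  | comp₂ t u v h h' =>
    have : 0 ∉ fv (swap t) := by rwa [mem_fv_swap]
    simp only [fv, Set.mem_union, Set.mem_ofPred_eq, mem_fv_unshift this, mem_fv_swap,
      swapIdx_add_two]
    tauto

namespace Term

theorem rename_psub (ρ : ℕ → ℕ) (t v : Term) :
    rename ρ (psub t v) = psub (rename (liftRen ρ) t) (rename ρ v) := by
  have key : up (fun n => var (ρ n)) = fun n => var (liftRen ρ n) := by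
    funext n; cases n <;> rfl
  simp only [rename_eq_subst, subst_psub, key]

theorem rename_gins (ρ : ℕ → ℕ) (t v : Term) :
    rename ρ (gins t v) = gins (rename ρ t) (rename ρ v) := by
  simp only [rename_eq_subst]
  exact subst_gins t (fun n s hs => by simp at hs) v

open Classical in
/-- A representative of the `ALC`-normal form, by structural recursion. -/
noncomputable def nf : Term → Term
  | var n => var n
  | app t u => app (nf t) (nf u)
  | lam t => lam (nf t)
  | clos t u => if 0 ∈ fv t then psub (nf t) (nf u) else gins (psub (nf t) (nf u)) (nf u)

theorem nf_clos_of_mem {t : Term} (h : 0 ∈ fv t) (u : Term) :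
    nf (clos t u) = psub (nf t) (nf u) := if_pos h

theorem nf_clos_of_notMem {t : Term} (h : 0 ∉ fv t) (u : Term) :
    nf (clos t u) = gins (psub (nf t) (nf u)) (nf u) := if_neg h

theorem mem_fv_nf (t : Term) : ∀ n, n ∈ fv (nf t) ↔ n ∈ fv t := by
  induction t with
  | var n => exact fun _ => Iff.rfl
  | app t u iht ihu => intro n; simp only [nf, fv, Set.mem_union, iht, ihu]
  | lam t ih => intro n; simp only [nf, fv, Set.mem_ofPred_eq, ih]
  | clos t u iht ihu =>
    intro n
    by_cases h : 0 ∈ fv t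
    · simp only [nf_clos_of_mem h, mem_fv_psub, iht, ihu, fv, Set.mem_union, Set.mem_ofPred_eq]
      tauto
    · simp only [nf_clos_of_notMem h, mem_fv_gins, mem_fv_psub, iht, ihu, fv, Set.mem_union,
        Set.mem_ofPred_eq]
      tauto

theorem nf_rename (t : Term) : ∀ ρ : ℕ → ℕ, nf (rename ρ t) = rename ρ (nf t) := by
  induction t with
  | var n => intro ρ; rfl
  | app t u iht ihu => intro ρ; simp only [rename, nf, iht, ihu]
  | lam t ih => intro ρ; simp only [rename, nf, ih]
  | clos t u iht ihu =>
    intro ρ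
    have h0 : 0 ∈ fv (rename (liftRen ρ) t) ↔ 0 ∈ fv t := by
      rw [mem_fv_rename]
      constructor
      · rintro ⟨n, hn, h⟩
        cases n with
        | zero => exact hn
        | succ n => simp at h
      · exact fun h => ⟨0, h, rfl⟩
    by_cases h : 0 ∈ fv t
    · rw [rename, nf_clos_of_mem h, nf_clos_of_mem (h0.2 h), iht, ihu, rename_psub]
    · rw [rename, nf_clos_of_notMem h, nf_clos_of_notMem (mt h0.1 h), iht, ihu, rename_gins,
        rename_psub]

theorem nf_shift (t : Term) : nf (shift t) = shift (nf t) := nf_rename t _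
theorem nf_unshift (t : Term) : nf (unshift t) = unshift (nf t) := nf_rename t _
theorem nf_swap (t : Term) : nf (swap t) = swap (nf t) := nf_rename t _

theorem psub_gins (t u v : Term) : psub (gins t u) v = gins (psub t v) (psub u v) :=
  subst_gins t (notLam_inst v) u

end Term

/-! ### Invariance of the normal form -/

theorem CRule.nf_esEq (t t' : Term) (h : CRule t t') : EsEq (nf t) (nf t') := by
  cases h with
  | c t u v hu =>
    have hu' : unshift (nf u) = psub (nf u) (nf v) :=
      (psub_eq_unshift (by rwa [mem_fv_nf]) _).symm
    have hl : 0 ∈ fv (clos t u) ↔ 1 ∈ fv t := by simp [fv, hu]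
    have hr : 0 ∈ fv (clos (swap t) (shift v)) ↔ 0 ∈ fv t := by
      simp [fv, mem_fv_swap, zero_notMem_fv_shift]
    have hs : 0 ∈ fv (swap t) ↔ 1 ∈ fv t := mem_fv_swap
    -- The two normal forms coincide literally unless both closures are garbage; only then is the
    -- congruence needed, through `EsEq.gins_gins`.
    by_cases h0 : 0 ∈ fv t <;> by_cases h1 : 1 ∈ fv t
    · rw [nf_clos_of_mem (hl.2 h1), nf_clos_of_mem h0, nf_clos_of_mem (hr.2 h0),
        nf_clos_of_mem (hs.2 h1), nf_swap, nf_shift, nf_unshift, hu', psub_psub_swap]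
      exact .refl _
    · rw [nf_clos_of_notMem (mt hl.1 h1), nf_clos_of_mem h0, nf_clos_of_mem (hr.2 h0),
        nf_clos_of_notMem (mt hs.1 h1), nf_swap, nf_shift, nf_unshift, hu', psub_gins,
        psub_psub_swap, psub_shift]
      exact .refl _
    · rw [nf_clos_of_mem (hl.2 h1), nf_clos_of_notMem h0, nf_clos_of_notMem (mt hr.1 h0),
        nf_clos_of_mem (hs.2 h1), nf_swap, nf_shift, nf_unshift, hu', psub_gins, psub_psub_swap]
      exact .refl _
    · rw [nf_clos_of_notMem (mt hl.1 h1), nf_clos_of_notMem h0, nf_clos_of_notMem (mt hr.1 h0),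
        nf_clos_of_notMem (mt hs.1 h1), nf_swap, nf_shift, nf_unshift, hu', psub_gins, psub_gins,
        psub_psub_swap, psub_shift]
      exact EsEq.gins_gins _ _ _

theorem AlcRule.nf_eq (t t' : Term) (h : AlcRule t t') : nf t = nf t' := by
  cases h with
  | app₁ t u v h h' =>
    rw [nf_clos_of_mem (t := app t u) (Or.inl h), nf, nf, nf_clos_of_mem h, nf_clos_of_mem h']
    rfl
  | app₂ t u v h h' =>
    rw [nf_clos_of_mem (t := app t u) (Or.inr h'), nf, nf, nf_clos_of_mem h', nf_unshift,
      ← psub_eq_unshift (by rwa [mem_fv_nf]) (nf v)]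
    rfl
  | app₃ t u v h h' =>
    rw [nf_clos_of_mem (t := app t u) (Or.inl h), nf, nf, nf_clos_of_mem h, nf_unshift,
      ← psub_eq_unshift (by rwa [mem_fv_nf]) (nf v)]
    rfl
  | lamb t v =>
    have hs : 0 ∈ fv (swap t) ↔ 0 ∈ fv (lam t) := mem_fv_swap
    by_cases h : 0 ∈ fv (lam t)
    · rw [nf_clos_of_mem h, nf, nf, nf_clos_of_mem (hs.2 h), psub_swap_lam, nf_swap, nf_shift]
    · rw [nf_clos_of_notMem h, nf, nf, nf_clos_of_notMem (mt hs.1 h), psub_swap_lam, nf_swap,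
        nf_shift, gins]
  | comp₁ t u v h h' =>
    have hr : 0 ∈ fv (clos (swap t) (shift v)) ↔ 0 ∈ fv t := by
      simp [fv, mem_fv_swap, zero_notMem_fv_shift]
    have hs : 0 ∈ fv (swap t) := mem_fv_swap.2 h'
    rw [nf_clos_of_mem (t := clos t u) (Or.inr h)]
    by_cases h0 : 0 ∈ fv t
    · rw [nf_clos_of_mem h0, nf_clos_of_mem (hr.2 h0), nf_clos_of_mem hs, nf_clos_of_mem h,
        nf_swap, nf_shift, psub_psub_swap]
    · rw [nf_clos_of_notMem h0, nf_clos_of_notMem (mt hr.1 h0), nf_clos_of_mem hs,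
        nf_clos_of_mem h, nf_swap, nf_shift, psub_psub_swap, psub_gins]
  | comp₂ t u v h h' =>
    have hs : 0 ∉ fv (swap t) := mt mem_fv_swap.1 h'
    have hr : 0 ∈ fv (unshift (swap t)) ↔ 0 ∈ fv t := by
      rw [mem_fv_unshift hs, mem_fv_swap]; rfl
    rw [nf_clos_of_mem (t := clos t u) (Or.inr h)]
    have he : psub (nf (unshift (swap t))) (psub (nf u) (nf v)) =
        psub (psub (nf t) (nf u)) (nf v) := by
      rw [← psub_psub_swap, nf_unshift, nf_swap, psub_eq_unshift (t := swap (nf t))]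
      rwa [← nf_swap, mem_fv_nf]
    by_cases h0 : 0 ∈ fv t
    · rw [nf_clos_of_mem h0, nf_clos_of_mem (hr.2 h0), nf_clos_of_mem h, he]
    · rw [nf_clos_of_notMem h0, nf_clos_of_notMem (mt hr.1 h0), nf_clos_of_mem h, he, psub_gins]

theorem Compat.nf_esEq {R : Term → Term → Prop}
    (hfv : ∀ t t', R t t' → ∀ n, n ∈ fv t ↔ n ∈ fv t')
    (hR : ∀ t t', R t t' → EsEq (nf t) (nf t')) {t t' : Term} (h : Compat R t t') :
    EsEq (nf t) (nf t') := by
  induction h with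
  | root h => exact hR _ _ h
  | appL u _ ih => exact ih.app (.refl _)
  | appR t _ ih => exact (EsEq.refl _).app ih
  | lam _ ih => exact ih.lam
  | @closL t t' u hc ih =>
    have hf := Compat.mem_fv_iff hfv hc 0
    by_cases h0 : 0 ∈ fv t
    · rw [nf_clos_of_mem h0, nf_clos_of_mem (hf.1 h0)]
      exact ih.psub (.refl _)
    · rw [nf_clos_of_notMem h0, nf_clos_of_notMem (mt hf.2 h0)]
      exact (ih.psub (.refl _)).gins (.refl _)
  | closR t _ ih =>
    by_cases h0 : 0 ∈ fv t
    · rw [nf_clos_of_mem h0, nf_clos_of_mem h0]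
      exact (EsEq.refl _).psub ih
    · rw [nf_clos_of_notMem h0, nf_clos_of_notMem h0]
      exact ((EsEq.refl _).psub ih).gins ih

theorem EsEq.nf {t t' : Term} (h : EsEq t t') : EsEq (nf t) (nf t') :=
  h.map fun _ _ => Compat.nf_esEq CRule.mem_fv_iff CRule.nf_esEq

theorem AlcStep.nf_esEq {t t' : Term} (h : AlcStep t t') : EsEq (nf t) (nf t') := by
  obtain ⟨s, s', h₁, h₂, h₃⟩ := h
  refine h₁.nf.trans (EsEq.trans ?_ h₃.nf)
  exact Compat.nf_esEq AlcRule.mem_fv_iff (fun _ _ h => AlcRule.nf_eq _ _ h ▸ .refl _) h₂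

theorem Red.nf_esEq {t t' : Term} (h : Red AlcRule t t') : EsEq (nf t) (nf t') := by
  rcases h with h | h
  · exact h.nf
  · induction h with
    | single h => exact AlcStep.nf_esEq h
    | tail _ h ih => exact ih.trans (AlcStep.nf_esEq h)

/-! ### Every term reduces to its normal form -/

theorem red_psub (t : Term) (h : 0 ∈ fv t) (v : Term) : Red AlcRule (clos t v) (psub t v) := by
  -- `Lamb`, `Comp₁` and equation `C` continue with `swap t`, which is not a subterm but has the
  -- same size as one.
  induction hn : size t using Nat.strong_induction_on generalizing t v with
  | _ n ih =>
  subst hn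
  have ih' : ∀ t' : Term, size t' < size t → 0 ∈ fv t' → ∀ v : Term,
    Red AlcRule (clos t' v) (psub t' v) := fun t' hs h' v => ih _ hs t' h' v rfl
  cases t with
  | var n =>
    obtain rfl : 0 = n := h
    exact .refl _
  | app t u =>
    have ht := ih' t (by simp only [size]; omega)
    have hu := ih' u (by simp only [size]; omega)
    change Red AlcRule _ (app (psub t v) (psub u v))
    by_cases h1 : 0 ∈ fv t <;> by_cases h2 : 0 ∈ fv u
    · exact (Red.of_rule (.app₁ t u v h1 h2)).trans ((ht h1 v).app (hu h2 v))
    · rw [psub_eq_unshift h2]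
      exact (Red.of_rule (.app₃ t u v h1 h2)).trans ((ht h1 v).app (.refl _))
    · rw [psub_eq_unshift h1]
      exact (Red.of_rule (.app₂ t u v h1 h2)).trans ((Red.refl _).app (hu h2 v))
    · exact (h.elim h1 h2).elim
  | lam t =>
    rw [psub_swap_lam]
    exact (Red.of_rule (.lamb t v)).trans
      (ih' (swap t) (by simp only [size, swap_eq, size_rename]; omega) (mem_fv_swap.2 h) _).lam
  | clos t u =>
    have ht := ih' (swap t) (by simp only [size, swap_eq, size_rename]; omega)
    have hu := ih' u (by simp only [size]; omega)
    rw [psub_clos]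
    by_cases h1 : 0 ∈ fv u
    · by_cases h2 : 1 ∈ fv t
      · exact (Red.of_rule (.comp₁ t u v h1 h2)).trans ((ht (mem_fv_swap.2 h2) _).clos (hu h1 v))
      · rw [psub_eq_unshift (mt mem_fv_swap.1 h2)]
        exact (Red.of_rule (.comp₂ t u v h1 h2)).trans ((Red.refl _).clos (hu h1 v))
    · rw [psub_eq_unshift h1]
      have h2 : 1 ∈ fv t := h.resolve_right h1
      -- No rule fires when the closures are independent; equation `C` moves the outer one inwards
      -- at the cost of zero steps.
      exact Red.trans (Or.inl (.of_crule (.c t u v h1)))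
        ((ht (mem_fv_swap.2 h2) _).clos (.refl _))

theorem red_gins (t : Term) : ∀ v : Term, Red AlcRule (clos (shift t) v) (gins t v) := by
  induction t with
  | lam t ih =>
    intro v
    -- Inserting an unused binder outside the abstraction and then exchanging the two is the same as
    -- inserting it innermost.
    have hs : swap (rename (liftRen Nat.succ) t) = shift t := by
      rw [swap_eq, rename_rename, shift]
      congr 1
      funext n
      cases n <;> rfl
    have := Red.of_rule (AlcRule.lamb (rename (liftRen Nat.succ) t) v)
    rw [hs] at this
    exact this.trans (ih _).lam
  | _ => exact fun v => .refl _

theorem red_gins_psub {t : Term} (h : 0 ∉ fv t) (v : Term) :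
    Red AlcRule (clos t v) (gins (psub t v) v) := by
  have := red_gins (psub t v) v
  rwa [psub_eq_unshift h, shift_unshift h, ← psub_eq_unshift h v] at this

theorem red_nf (t : Term) : Red AlcRule t (nf t) := by
  induction t with
  | var n => exact .refl _
  | app t u iht ihu => exact iht.app ihu
  | lam t ih => exact ih.lam
  | clos t u iht ihu =>
    refine (iht.clos ihu).trans ?_
    by_cases h : 0 ∈ fv t
    · rw [nf_clos_of_mem h]
      exact red_psub _ ((mem_fv_nf _ _).2 h) _
    · rw [nf_clos_of_notMem h]
      exact red_gins_psub (mt (mem_fv_nf _ _).1 h) _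

/-! ### A syntactic description of normal terms -/

namespace Term

/-- No closure of the variable `k` over `t` can be propagated into `t`. -/
def Blocked : ℕ → Term → Prop
  | _, var _ => True
  | k, app t u => k ∉ fv (app t u)
  | _, lam _ => False
  | k, clos t u => Blocked (k + 1) t ∧ k ∉ fv u

/-- Every closure of the term is blocked. -/
def NF : Term → Prop
  | var _ => True
  | app t u => NF t ∧ NF u
  | lam t => NF t
  | clos t u => NF t ∧ NF u ∧ Blocked 0 t

/-- A variable, possibly under one closure. -/
def VarLike (s : Term) : Prop := ∃ m, s = var m ∨ ∃ v, s = clos (var m) v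

theorem VarLike.rename {s : Term} (h : VarLike s) (ρ : ℕ → ℕ) : VarLike (rename ρ s) := by
  obtain ⟨m, rfl | ⟨v, rfl⟩⟩ := h
  · exact ⟨_, Or.inl rfl⟩
  · exact ⟨_, Or.inr ⟨_, rfl⟩⟩

theorem varLike_up {σ : ℕ → Term} (h : ∀ n, VarLike (σ n)) (n : ℕ) : VarLike (up σ n) := by
  cases n with
  | zero => exact ⟨0, Or.inl rfl⟩
  | succ n => exact (h n).rename _

theorem varLike_inst (v : Term) (n : ℕ) : VarLike (inst v n) := by
  cases n with
  | zero => exact ⟨_, Or.inr ⟨_, rfl⟩⟩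
  | succ n => exact ⟨_, Or.inl rfl⟩

/-- `VarLike` values cannot create a redex: a closure over `m` or `m[x/v]` remains stuck, provided
its variable is not free in `v`. The values of `inst` have this shape. -/
theorem Blocked.subst {t : Term} : ∀ {k k' : ℕ} {σ : ℕ → Term}, Blocked k t →
    (∀ n, VarLike (σ n)) → σ k = var k' → (∀ n, n ≠ k → k' ∉ fv (σ n)) →
    Blocked k' (subst σ t) := by
  have key : ∀ {t : Term} {k k' : ℕ} {σ : ℕ → Term}, k ∉ fv t →
      (∀ n, n ≠ k → k' ∉ fv (σ n)) → k' ∉ fv (Term.subst σ t) := by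
    intro t k k' σ h hσ hm
    obtain ⟨n, hn, hk⟩ := (mem_fv_subst t).1 hm
    exact hσ n (by rintro rfl; exact h hn) hk
  induction t with
  | var n =>
    intro k k' σ _ hv hk hσ
    change Blocked k' (σ n)
    by_cases hn : n = k
    · rw [hn, hk]; trivial
    · have := hσ n hn
      obtain ⟨m, e | ⟨v, e⟩⟩ := hv n
      · rw [e]; trivial
      · rw [e] at this ⊢
        exact ⟨trivial, fun hm => this (Or.inr hm)⟩
  | app t u => exact fun h _ _ hσ => key (t := app t u) h hσ
  | lam t => exact fun h => h.elim
  | clos t u iht =>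
    rintro k k' σ ⟨ht, hu⟩ hv hk hσ
    refine ⟨iht ht (varLike_up hv) (by rw [up_succ, hk]; rfl) fun n hn => ?_, key hu hσ⟩
    cases n with
    | zero => simp [fv]
    | succ n => exact mt succ_mem_fv_shift.1 (hσ n (by rintro rfl; exact hn rfl))

theorem Blocked.rename {t : Term} {k : ℕ} {ρ : ℕ → ℕ} (h : Blocked k t)
    (hρ : ∀ n, n ≠ k → ρ n ≠ ρ k) : Blocked (ρ k) (rename ρ t) := by
  rw [rename_eq_subst]
  exact h.subst (fun n => ⟨_, Or.inl rfl⟩) rfl fun n hn => by simpa [fv] using (hρ n hn).symm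

theorem NF.subst {t : Term} : ∀ {σ : ℕ → Term}, NF t → (∀ n, NF (σ n)) → (∀ n, VarLike (σ n)) →
    NF (subst σ t) := by
  have hren : ∀ {t : Term} {ρ : ℕ → ℕ}, NF t → NF (Term.rename ρ t) := by
    intro t
    induction t with
    | var n => exact fun _ => trivial
    | app t u iht ihu => exact fun h => ⟨iht h.1, ihu h.2⟩
    | lam t ih => exact fun h => ih h
    | clos t u iht ihu =>
      refine fun h => ⟨iht h.1, ihu h.2.1, h.2.2.rename (ρ := liftRen _) fun n hn => ?_⟩
      cases n with
      | zero => exact absurd rfl hn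
      | succ n => simp
  have hup : ∀ {σ : ℕ → Term}, (∀ n, NF (σ n)) → ∀ n, NF (up σ n) := by
    intro σ h n
    cases n with
    | zero => trivial
    | succ n => exact hren (h n)
  induction t with
  | var n => exact fun _ h _ => h n
  | app t u iht ihu => exact fun h hσ hv => ⟨iht h.1 hσ hv, ihu h.2 hσ hv⟩
  | lam t ih => exact fun h hσ hv => ih h (hup hσ) (varLike_up hv)
  | clos t u iht ihu =>
    intro σ h hσ hv
    refine ⟨iht h.1 (hup hσ) (varLike_up hv), ihu h.2.1 hσ hv, h.2.2.subst (varLike_up hv) rfl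
      fun n hn => ?_⟩
    cases n with
    | zero => exact absurd rfl hn
    | succ n => exact zero_notMem_fv_shift _

theorem NF.rename {t : Term} (h : NF t) (ρ : ℕ → ℕ) : NF (rename ρ t) := by
  rw [rename_eq_subst]
  exact h.subst (fun _ => trivial) fun n => ⟨_, Or.inl rfl⟩

theorem NF.psub {t v : Term} (ht : NF t) (hv : NF v) : NF (psub t v) := by
  refine ht.subst (fun n => ?_) (varLike_inst v)
  cases n with
  | zero => exact ⟨trivial, hv, trivial⟩
  | succ n => trivial

theorem Blocked.notLam {k : ℕ} {t : Term} (h : Blocked k t) : NotLam t := by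
  rintro s rfl
  exact h

/-- A garbage closure can only move through an abstraction, and `NF` excludes one hidden beneath
further closures. -/
theorem blocked_of_notMem {t : Term} : ∀ {k : ℕ}, NF t → NotLam t → k ∉ fv t → Blocked k t := by
  induction t with
  | var n => exact fun _ _ _ => trivial
  | app t u => exact fun _ _ h => h
  | lam t => exact fun _ h _ => absurd rfl (h t)
  | clos t u iht =>
    exact fun h _ hk => ⟨iht h.1 h.2.2.notLam fun h' => hk (Or.inl h'), fun h' => hk (Or.inr h')⟩

theorem NF.gins {t : Term} : ∀ {v : Term}, NF t → NF v → NF (gins t v) := by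
  have key : ∀ {t v : Term}, NotLam t → NF t → NF v → NF (Term.gins t v) := by
    intro t v h ht hv
    rw [gins_of_notLam h]
    exact ⟨ht.rename _, hv, blocked_of_notMem (ht.rename _) (h.rename _) (zero_notMem_fv_shift t)⟩
  induction t with
  | lam t ih => exact fun ht hv => ih ht (hv.rename _)
  | _ => exact key (by intro s hs; simp at hs)

theorem nf_NF (t : Term) : NF (nf t) := by
  induction t with
  | var n => trivial
  | app t u iht ihu => exact ⟨iht, ihu⟩
  | lam t ih => exact ih
  | clos t u iht ihu =>
    by_cases h : 0 ∈ fv t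
    · rw [nf_clos_of_mem h]
      exact iht.psub ihu
    · rw [nf_clos_of_notMem h]
      exact (iht.psub ihu).gins ihu

theorem Blocked.swap {t : Term} {k : ℕ} (h : Blocked k t) : Blocked (swapIdx k) (swap t) := by
  refine h.rename fun n hn => ?_
  match n, k with
  | 0, 0 => exact absurd rfl hn
  | 1, 1 => exact absurd rfl hn
  | 0, 1 => simp
  | 1, 0 => simp
  | 0, k + 2 => simp
  | 1, k + 2 => simp
  | n + 2, 0 => simp
  | n + 2, 1 => simp
  | n + 2, k + 2 => exact hn

end Term

theorem CRule.blocked (t t' : Term) (h : CRule t t') (k : ℕ) (hb : Blocked k t) :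
    Blocked k t' := by
  cases h with
  | c t u v hu =>
    obtain ⟨⟨ht, hk⟩, hv⟩ := hb
    exact ⟨⟨ht.swap, mt succ_mem_fv_shift.1 hv⟩, mt (mem_fv_unshift hu).1 hk⟩

theorem CRule.NF_of_NF (t t' : Term) (h : CRule t t') (hn : NF t) : NF t' := by
  cases h with
  | c t u v hu =>
    obtain ⟨⟨ht, hu', hb⟩, hv, hb', _⟩ := hn
    exact ⟨⟨ht.rename _, hv.rename _, hb'.swap⟩, hu'.rename _, hb.swap, zero_notMem_fv_shift v⟩

/-- `NF` mentions `Blocked` for the body of a closure, so its invariance needs this one. -/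
theorem Compat.blocked {t t' : Term} (h : Compat CRule t t') :
    ∀ k, Blocked k t → Blocked k t' := by
  have hfv : ∀ {t t' : Term}, Compat CRule t t' → ∀ {n}, n ∈ fv t' → n ∈ fv t :=
    fun h n => (Compat.mem_fv_iff CRule.mem_fv_iff h n).2
  induction h with
  | root h => exact CRule.blocked _ _ h
  | appL u h _ => exact fun k => mt (hfv (.appL u h))
  | appR t h _ => exact fun k => mt (hfv (.appR t h))
  | lam _ _ => exact fun k h => h
  | closL u _ ih => exact fun k h => ⟨ih _ h.1, h.2⟩
  | closR t h _ => exact fun k hb => ⟨hb.1, mt (hfv h) hb.2⟩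

theorem Compat.NF_of_NF {t t' : Term} (h : Compat CRule t t') : NF t → NF t' := by
  induction h with
  | root h => exact CRule.NF_of_NF _ _ h
  | appL u _ ih => exact fun h => ⟨ih h.1, h.2⟩
  | appR t _ ih => exact fun h => ⟨h.1, ih h.2⟩
  | lam _ ih => exact fun h => ih h
  | closL u hc ih => exact fun h => ⟨ih h.1, h.2.1, hc.blocked _ h.2.2⟩
  | closR t _ ih => exact fun h => ⟨h.1, ih h.2.1, h.2.2⟩

theorem EsEq.NF_iff {t t' : Term} (h : EsEq t t') : NF t ↔ NF t' := by
  induction h with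
  | rel _ _ h => exact ⟨h.NF_of_NF, (h.symm CRule.symm).NF_of_NF⟩
  | refl _ => exact Iff.rfl
  | symm _ _ _ ih => exact ih.symm
  | trans _ _ _ _ _ ih ih' => exact ih.trans ih'

theorem Compat.not_NF {t t' : Term} (h : Compat AlcRule t t') : ¬ NF t := by
  induction h with
  | root h =>
    cases h with
    | app₁ t u v h h' => exact fun hn => hn.2.2 (Or.inl h)
    | app₂ t u v h h' => exact fun hn => hn.2.2 (Or.inr h')
    | app₃ t u v h h' => exact fun hn => hn.2.2 (Or.inl h)
    | lamb t v => exact fun hn => hn.2.2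
    | comp₁ t u v h h' => exact fun hn => hn.2.2.2 h
    | comp₂ t u v h h' => exact fun hn => hn.2.2.2 h
  | appL u _ ih => exact fun h => ih h.1
  | appR t _ ih => exact fun h => ih h.2
  | lam _ ih => exact fun h => ih h
  | closL u hc ih => exact fun h => ih h.1
  | closR t _ ih => exact fun h => ih h.2.1

theorem Term.NF.alcNormal {t : Term} (h : NF t) : AlcNormal t := by
  rintro t' ⟨s, s', h₁, h₂, -⟩
  exact h₂.not_NF (h₁.NF_iff.1 h)

/-! ### Uniqueness of normal forms -/

theorem AlcNormal.esEq_of_red {t s : Term} (h : AlcNormal t) (hr : Red AlcRule t s) :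
    EsEq t s := by
  rcases hr with hr | hr
  · exact hr
  · obtain ⟨w, hw, -⟩ := TransGen.head'_iff.1 hr
    exact absurd hw (h w)

theorem AlcNormal.esEq_nf {t : Term} (h : AlcNormal t) : EsEq t (nf t) :=
  h.esEq_of_red (red_nf t)

theorem isAlcNormalForm_nf (t : Term) : IsAlcNormalForm t (nf t) :=
  ⟨red_nf t, (nf_NF t).alcNormal⟩

theorem isAlcNormalForm_alc (t : Term) : IsAlcNormalForm t (alc t) := by
  have h : ∃ s, IsAlcNormalForm t s := ⟨_, isAlcNormalForm_nf t⟩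
  rw [alc, dif_pos h]
  exact h.choose_spec

/-- Normality gives `s` equal to `nf s` modulo `EsEq`, and the reduction from `t` to `s` preserves
`nf`. -/
theorem IsAlcNormalForm.esEq_nf {t s : Term} (h : IsAlcNormalForm t s) : EsEq s (nf t) :=
  h.2.esEq_nf.trans (Red.nf_esEq h.1).symm

theorem IsAlcNormalForm.esEq {t s s' : Term} (h : IsAlcNormalForm t s)
    (h' : IsAlcNormalForm t s') : EsEq s s' := h.esEq_nf.trans h'.esEq_nf.symm
/-! ### Reductions are stable under substitution -/

theorem AlcRule.subst : SubstClosed AlcRule := by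
  intro t t' h σ
  cases h with
  | app₁ t u v h h' =>
    exact .app₁ _ _ _ (zero_mem_fv_subst_up.2 h) (zero_mem_fv_subst_up.2 h')
  | app₂ t u v h h' =>
    simp only [Term.subst, subst_unshift h]
    exact .app₂ _ _ _ (mt zero_mem_fv_subst_up.1 h) (zero_mem_fv_subst_up.2 h')
  | app₃ t u v h h' =>
    simp only [Term.subst, subst_unshift h']
    exact .app₃ _ _ _ (zero_mem_fv_subst_up.2 h) (mt zero_mem_fv_subst_up.1 h')
  | lamb t v =>
    simp only [Term.subst, subst_swap, subst_shift]
    exact .lamb _ _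
  | comp₁ t u v h h' =>
    simp only [Term.subst, subst_swap, subst_shift]
    exact .comp₁ _ _ _ (zero_mem_fv_subst_up.2 h) (one_mem_fv_subst_up_up.2 h')
  | comp₂ t u v h h' =>
    simp only [Term.subst, subst_unshift (mt mem_fv_swap.1 h'), subst_swap]
    exact .comp₂ _ _ _ (zero_mem_fv_subst_up.2 h) (mt one_mem_fv_subst_up_up.1 h')

theorem BsRule.subst : SubstClosed BsRule := by
  intro t t' h σ
  cases h with
  | b t u => exact .b _ _
  | var u => exact .var _
  | gc t u h =>
    rw [subst_unshift h]
    exact .gc _ _ (mt zero_mem_fv_subst_up.1 h)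
  | alc h => exact .alc (AlcRule.subst h σ)

theorem Red.bsRule {t u : Term} (h : Red AlcRule t u) : Red BsRule t u :=
  h.map (f := fun t => t) (fun _ _ h => h) fun _ _ => Compat.mono fun _ _ => .alc

theorem Red.rename {R : Term → Term → Prop} (hR : SubstClosed R) {t u : Term} (h : Red R t u)
    (ρ : ℕ → ℕ) : Red R (rename ρ t) (rename ρ u) := by
  rw [rename_eq_subst, rename_eq_subst]
  exact h.subst hR _

theorem Red.psub_right {R : Term → Term → Prop} (hR : SubstClosed R) (t : Term) {v v' : Term}
    (hv : Red R v v') : Red R (psub t v) (psub t v') := by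
  have key : ∀ (t : Term) {σ τ : ℕ → Term}, (∀ n, Red R (σ n) (τ n)) →
      Red R (Term.subst σ t) (Term.subst τ t) := by
    have hup : ∀ {σ τ : ℕ → Term}, (∀ n, Red R (σ n) (τ n)) →
        ∀ n, Red R (up σ n) (up τ n) := by
      intro σ τ h n
      cases n with
      | zero => exact .refl _
      | succ n => exact (h n).rename hR _
    intro t
    induction t with
    | var n => exact fun h => h n
    | app t u iht ihu => exact fun h => (iht h).app (ihu h)
    | lam t ih => exact fun h => (ih (hup h)).lam
    | clos t u iht ihu => exact fun h => (iht (hup h)).clos (ihu h)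
  refine key _ fun n => ?_
  cases n with
  | zero => exact (Red.refl _).clos hv
  | succ n => exact .refl _

theorem red_gins_psub_of_mem {t : Term} (h : 0 ∈ fv t) (v : Term) :
    Red AlcRule (clos (shift (clos t v)) v) (gins (psub t v) v) :=
  (((red_psub t h v).rename AlcRule.subst _).clos (.refl _)).trans (red_gins _ _)

/-- One or more steps of the `λes`-calculus. -/
def EsPlus : Term → Term → Prop := TransGen EsStep

namespace EsPlus

variable {t t' u u' v v' : Term}

theorem of_compat (h : Compat BsRule t t') : EsPlus t t' := .single (.of_compat h)

theorem map {f : Term → Term} (he : ∀ t t', EsEq t t' → EsEq (f t) (f t'))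
    (hs : ∀ t t', Compat BsRule t t' → EsPlus (f t) (f t')) (h : EsPlus t u) :
    EsPlus (f t) (f u) := by
  have step : ∀ {t u}, EsStep t u → EsPlus (f t) (f u) := by
    rintro t u ⟨s, s', h₁, h₂, h₃⟩
    exact plus_trans_esEq ((he _ _ h₁).trans_plus (hs _ _ h₂)) (he _ _ h₃)
  induction h with
  | single h => exact step h
  | tail _ h ih => exact TransGen.trans ih (step h)

theorem app_left (h : EsPlus t t') (u : Term) : EsPlus (app t u) (app t' u) :=
  h.map (f := fun t => app t u) (fun _ _ h => h.app (.refl _)) fun _ _ h => of_compat (.appL _ h)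

theorem app_right (t : Term) (h : EsPlus u u') : EsPlus (app t u) (app t u') :=
  h.map (fun _ _ h => (EsEq.refl _).app h) fun _ _ h => of_compat (.appR _ h)

theorem lam (h : EsPlus t t') : EsPlus (lam t) (lam t') :=
  h.map (fun _ _ h => h.lam) fun _ _ h => of_compat (.lam h)

theorem clos_left (h : EsPlus t t') (u : Term) : EsPlus (clos t u) (clos t' u) :=
  h.map (f := fun t => clos t u) (fun _ _ h => h.clos (.refl _))
    fun _ _ h => of_compat (.closL _ h)

theorem clos_right (t : Term) (h : EsPlus u u') : EsPlus (clos t u) (clos t u') :=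
  h.map (fun _ _ h => (EsEq.refl _).clos h) fun _ _ h => of_compat (.closR _ h)

theorem subst (h : EsPlus t t') (σ : ℕ → Term) : EsPlus (subst σ t) (subst σ t') :=
  h.map (fun _ _ h => EsEq.subst h σ) fun _ _ h => of_compat (Compat.subst BsRule.subst h σ)

theorem rename (h : EsPlus t t') (ρ : ℕ → ℕ) : EsPlus (rename ρ t) (rename ρ t') := by
  rw [rename_eq_subst, rename_eq_subst]
  exact h.subst _

theorem gins_left (h : EsPlus t t') (v : Term) : EsPlus (gins t v) (gins t' v) := by
  refine h.map (f := fun t => gins t v) (fun _ _ h => h.gins (.refl _)) fun t t' h => ?_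
  have key : ∀ {t t' : Term}, NotLam t → Compat BsRule t t' → ∀ v,
      EsPlus (gins t v) (gins t' v) := by
    intro t t' hn h v
    rw [gins_of_notLam hn]
    -- The contractum may be an abstraction, as in `x[x/λ y. s]`; the closure must then be pushed
    -- below it.
    exact Red.plus_trans (((of_compat h).rename _).clos_left v) (red_gins t' v).bsRule
  induction h generalizing v with
  | root h =>
    -- No left-hand side of a rule is an abstraction.
    refine key (fun s hs => ?_) (.root h) v
    subst hs
    cases h with
    | alc h => cases h
  | lam _ ih => exact (ih _).lam
  | appL u h => exact key (by intro s hs; simp at hs) (.appL u h) v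
  | appR u h => exact key (by intro s hs; simp at hs) (.appR u h) v
  | closL u h => exact key (by intro s hs; simp at hs) (.closL u h) v
  | closR u h => exact key (by intro s hs; simp at hs) (.closR u h) v

theorem gins_right (t : Term) : ∀ {v v' : Term}, EsPlus v v' → EsPlus (gins t v) (gins t v') := by
  induction t with
  | lam t ih => exact fun h => (ih (h.rename _)).lam
  | _ => exact fun h => clos_right _ h

theorem tr_app_left (h : EsPlus t t') (u : Term) :
    EsPlus (clos (shift (app t u)) u) (clos (shift (app t' u)) u) :=
  ((h.app_left u).rename _).clos_left u

theorem tr_app_right (t : Term) (h : EsPlus u u') :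
    EsPlus (clos (shift (app t u)) u) (clos (shift (app t u')) u') :=
  TransGen.trans (((h.app_right t).rename _).clos_left u) (h.clos_right _)

theorem tr_clos_left (h : EsPlus t t') (u : Term) :
    EsPlus (gins (psub t u) u) (gins (psub t' u) u) :=
  (h.subst _).gins_left u

/-- The copies inside `psub` may be absent and contribute no step; the garbage copy held by `gins`
guarantees at least one. -/
theorem tr_clos_right (t : Term) (h : EsPlus u u') :
    EsPlus (gins (psub t u) u) (gins (psub t u') u') := by
  refine Red.trans_plus ?_ (h.gins_right _)
  rcases Red.psub_right BsRule.subst t (Or.inr h) with h | h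
  · exact Or.inl (h.gins (.refl _))
  · exact Or.inr (gins_left h u)

theorem gins_gc (t : Term) : ∀ v : Term, EsPlus (gins t v) t := by
  have key : ∀ t v : Term, EsPlus (clos (shift t) v) t := by
    intro t v
    have := of_compat (.root (BsRule.gc (shift t) v (zero_notMem_fv_shift t)))
    rwa [unshift_shift] at this
  induction t with
  | lam t ih => exact fun v => (ih _).lam
  | _ => exact key _

end EsPlus

/-! ### The translation, computed -/

namespace Term

/-- A representative modulo `EsEq` of the translation, by structural recursion. -/
def tr : Term → Term
  | var n => var n
  | lam t => lam (tr t)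
  | app t u => clos (shift (app (tr t) (tr u))) (tr u)
  | clos t u => gins (psub (tr t) (tr u)) (tr u)

theorem mem_fv_tr (t : Term) : ∀ n, n ∈ fv (tr t) ↔ n ∈ fv t := by
  induction t with
  | var n => exact fun _ => Iff.rfl
  | app t u iht ihu =>
    intro n
    simp only [tr, fv, Set.mem_union, Set.mem_ofPred_eq, succ_mem_fv_shift, iht, ihu]
    tauto
  | lam t ih => intro n; simp only [tr, fv, Set.mem_ofPred_eq, ih]
  | clos t u iht ihu =>
    intro n
    simp only [tr, fv, Set.mem_union, Set.mem_ofPred_eq, mem_fv_gins, mem_fv_psub, iht, ihu]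
    tauto

theorem tr_rename (t : Term) : ∀ ρ : ℕ → ℕ, tr (rename ρ t) = rename ρ (tr t) := by
  induction t with
  | var n => intro ρ; rfl
  | app t u iht ihu => intro ρ; simp only [rename, tr, iht, ihu, rename_shift]
  | lam t ih => intro ρ; simp only [rename, tr, ih]
  | clos t u iht ihu => intro ρ; simp only [rename, tr, iht, ihu, rename_psub, rename_gins]

theorem tr_NF (t : Term) : NF (tr t) := by
  induction t with
  | var n => trivial
  | app t u iht ihu =>
    exact ⟨NF.rename (t := app _ _) ⟨iht, ihu⟩ _, ihu, zero_notMem_fv_shift (app (tr t) (tr u))⟩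
  | lam t ih => exact ih
  | clos t u iht ihu => exact (iht.psub ihu).gins ihu

end Term

theorem tra_esEq_tr (t : Term) : EsEq (tra t) (tr t) := by
  -- Uniqueness determines the arbitrary choice: any `NF` reduct computes `alc` modulo `EsEq`.
  have halc : ∀ {s s' : Term}, Red AlcRule s s' → NF s' → EsEq (alc s) s' := fun h h' =>
    (isAlcNormalForm_alc _).esEq ⟨h, h'.alcNormal⟩
  induction t with
  | var n => exact .refl _
  | app t u iht ihu => exact ((iht.app ihu).rename _).clos ihu
  | lam t ih => exact ih.lam
  | clos t u iht ihu =>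
    have hn : NF (tr (clos t u)) := tr_NF _
    by_cases h : 0 ∈ fv t
    · rw [tra, if_pos h]
      refine halc (Red.trans (Or.inl (((iht.clos ihu).rename _).clos ihu)) ?_) hn
      exact red_gins_psub_of_mem ((mem_fv_tr _ _).2 h) _
    · rw [tra, if_neg h]
      exact halc (Red.trans (Or.inl (iht.clos ihu))
        (red_gins_psub (mt (mem_fv_tr _ _).1 h) _)) hn

theorem alcNormal_tra (t : Term) : AlcNormal (tra t) :=
  ((tra_esEq_tr t).NF_iff.2 (tr_NF t)).alcNormal

/-! ### Simulation -/

/-- The intended `σ` is `inst (tr u)` at `n = 0`; binders of `C` turn it into iterated `up`s and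
increase `n`, hence the general form. `NotLam` allows `σ` to pass through `gins`. -/
theorem esPlus_tr_fill (C : Ctx) : ∀ {n : ℕ} {s : Term} {σ : ℕ → Term}, (∀ m, NotLam (σ m)) →
    EsPlus (σ n) (subst σ (tr s)) →
    EsPlus (subst σ (tr (C.fill (var n)))) (subst σ (tr (C.fill s))) := by
  have hup : ∀ {n : ℕ} {s : Term} {σ : ℕ → Term}, EsPlus (σ n) (subst σ (tr s)) →
      EsPlus (up σ (n + 1)) (subst (up σ) (tr (shift s))) := by
    intro n s σ h
    rw [shift, tr_rename]
    exact subst_shift σ (tr s) ▸ h.rename _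
  induction C with
  | hole => exact fun _ h => h
  | appL C t ih =>
    intro n s σ hσ h
    simp only [Ctx.fill, tr, subst, subst_shift]
    exact (ih hσ h).tr_app_left _
  | appR t C ih =>
    intro n s σ hσ h
    simp only [Ctx.fill, tr, subst, subst_shift]
    exact (ih hσ h).tr_app_right _
  | lam C ih => exact fun hσ h => (ih (notLam_up hσ) (hup h)).lam
  | closL C t ih =>
    intro n s σ hσ h
    simp only [Ctx.fill, tr, subst_gins _ hσ, subst_psub]
    exact (ih (notLam_up hσ) (hup h)).tr_clos_left _
  | closR t C ih =>
    intro n s σ hσ h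
    simp only [Ctx.fill, tr, subst_gins _ hσ, subst_psub]
    exact (ih hσ h).tr_clos_right _

theorem SubRule.esPlus_tr {t t' : Term} (h : SubRule t t') : EsPlus (tr t) (tr t') := by
  cases h with
  | b t u =>
    have hb : EsPlus (tr (app (lam t) u)) (clos (shift (clos (tr t) (tr u))) (tr u)) :=
      .of_compat (.closL _ (.root (.b _ _)))
    refine Red.plus_trans hb ?_
    by_cases h : 0 ∈ fv t
    · exact (red_gins_psub_of_mem ((mem_fv_tr _ _).2 h) _).bsRule
    -- Both closures are garbage here, while `tr` keeps only one, so `Gc` removes the extra copy.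
    · exact Red.trans (Or.inr (EsPlus.gins_gc (clos (tr t) (tr u)) (tr u)))
        (red_gins_psub (mt (mem_fv_tr _ _).1 h) _).bsRule
  | gc t u h =>
    rw [unshift, tr_rename, ← unshift, ← psub_eq_unshift (mt (mem_fv_tr _ _).1 h) (tr u)]
    exact EsPlus.gins_gc _ _
  | r C u =>
    refine EsPlus.gins_left (esPlus_tr_fill C (notLam_inst _) ?_) _
    -- The inserted `u` does not mention `x`, so the pending substitution leaves it alone and `Var`
    -- reaches exactly `tr u`.
    have e : subst (inst (tr u)) (rename Nat.succ (tr u)) = tr u := psub_shift _ _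
    rw [shift, tr_rename, e]
    exact .of_compat (.root (.var _))

theorem SubStep.esPlus_tr {t t' : Term} (h : SubStep t t') : EsPlus (tr t) (tr t') := by
  induction h with
  | root h => exact h.esPlus_tr
  | appL u _ ih => exact ih.tr_app_left _
  | appR t _ ih => exact ih.tr_app_right _
  | lam _ ih => exact ih.lam
  | closL u _ ih => exact ih.tr_clos_left _
  | closR t _ ih => exact ih.tr_clos_right _

end LambdaSub

theorem propositionp :
    (∀ t : LambdaSub.Term, LambdaSub.IsAlcNormalForm t (LambdaSub.alc t) ∧
      ∀ s : LambdaSub.Term, LambdaSub.IsAlcNormalForm t s →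
        LambdaSub.EsEq s (LambdaSub.alc t)) ∧
    (∀ t : LambdaSub.Term, LambdaSub.AlcNormal (LambdaSub.tra t)) ∧
    ∀ t t' : LambdaSub.Term, LambdaSub.SubStep t t' →
      Relation.TransGen LambdaSub.EsStep (LambdaSub.tra t) (LambdaSub.tra t') := by
  refine ⟨fun t => ⟨LambdaSub.isAlcNormalForm_alc t, fun s hs =>
    hs.esEq (LambdaSub.isAlcNormalForm_alc t)⟩, LambdaSub.alcNormal_tra, fun t t' h => ?_⟩
  exact LambdaSub.plus_trans_esEq ((LambdaSub.tra_esEq_tr t).trans_plus h.esPlus_tr)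
    (LambdaSub.tra_esEq_tr t').symm
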